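/- Let $X$ be a regular ($T_3$) locally Menger $p$-space and let $Y = bX\setminus X$ be the remainder of $X$ in a Hausdorff compactification $bX$ of $X$. Then there is a compact subspace $K\subseteq Y$ such that every closed subset $F$ of $Y$ with $F\cap K=\emptyset$ is, in the subspace topology, a Lindelöf $p$-space, and hence also an $s$-space. Here a space $X$ is Menger if for every sequence $(\mathcal U_n)$ of open covers of $X$ there are finite $\mathcal V_n\subseteq\mathcal U_n$ with $\bigcup_n\bigcup\mathcal V_n=X$, and locally Menger if every $x\in X$ has an open set $U$ and a Menger subspace $M$ of $X$ with $x\in U\subseteq M$. A Tychonoff space $X$ is a $p$-space if in some (equivalently, any) Hausdorff compactification $bX$ there are families $\mathcal U_n$ $(n\in\mathbb N)$ of open subsets of $bX$ such that $x\in\bigcap_n\bigcup\{U\in\mathcal U_n: x\in U\}\subseteq X$ for every $x\in X$. It is an $s$-space if in some (equivalently, any) Hausdorff compactification $bX$ there is a countable family $\mathcal C$ of open subsets of $bX$ such that $X$ is a union of sets each of which is the intersection of a nonempty subfamily of $\mathcal C$. -/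

import Mathlib

open Set

universe u v w

/-- A space is Menger if for each sequence of open covers one can pick finite subfamilies which
together cover the space. -/
def IsMenger (X : Type u) [TopologicalSpace X] : Prop :=
  ∀ 𝒰 : ℕ → Set (Set X), (∀ n, (∀ U ∈ 𝒰 n, IsOpen U) ∧ ⋃₀ (𝒰 n) = univ) →
    ∃ 𝒱 : ℕ → Set (Set X), (∀ n, 𝒱 n ⊆ 𝒰 n ∧ (𝒱 n).Finite) ∧ (⋃ n, ⋃₀ (𝒱 n)) = univ

/-- A space is locally Menger if each point lies in an open set contained in a Menger subspace. -/
def IsLocallyMenger (X : Type u) [TopologicalSpace X] : Prop :=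
  ∀ x : X, ∃ U Y : Set X, IsOpen U ∧ IsMenger ↥Y ∧ x ∈ U ∧ U ⊆ Y

/-- `e : X → B` is a (Hausdorff) compactification of `X`. -/
structure IsCompactification {X : Type u} {B : Type v} [TopologicalSpace X] [TopologicalSpace B]
    (e : X → B) : Prop where
  compactSpace : CompactSpace B
  t2Space : T2Space B
  isDenseEmbedding : IsDenseEmbedding e

/-- The remainder of `X` in the compactification `e : X → B`; as a space it carries the subspace
topology of `B`. -/
def remainder {X : Type u} {B : Type v} (e : X → B) : Set B := (range e)ᶜ

/-- The star of the point `b` with respect to the family `𝒰`. -/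
def pointStar {B : Type v} (b : B) (𝒰 : Set (Set B)) : Set B := ⋃₀ {U | U ∈ 𝒰 ∧ b ∈ U}

/-- The defining condition of a `p`-space, in the given compactification `e : X → B`. -/
def IsPSpaceIn {X : Type u} {B : Type v} [TopologicalSpace B] (e : X → B) : Prop :=
  ∃ 𝒰 : ℕ → Set (Set B), (∀ n, ∀ U ∈ 𝒰 n, IsOpen U) ∧
    ∀ x : X, e x ∈ (⋂ n, pointStar (e x) (𝒰 n)) ∧ (⋂ n, pointStar (e x) (𝒰 n)) ⊆ range e

/-- `X` is a `p`-space: the condition holds in some compactification of `X`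
(equivalently in any, see `IsPSpace.forall_compactification`). -/
def IsPSpace (X : Type u) [TopologicalSpace X] : Prop :=
  ∃ (B : Type u) (_ : TopologicalSpace B) (e : X → B), IsCompactification e ∧ IsPSpaceIn e

/-- All intersections of nonempty subcollections of `𝒞`. -/
def deltaFamily {B : Type v} (𝒞 : Set (Set B)) : Set (Set B) :=
  {A | ∃ 𝒮 ⊆ 𝒞, 𝒮.Nonempty ∧ A = ⋂₀ 𝒮}

/-- `𝒞` is a source for the subspace `Y`: `Y` is a union of some subcollection of the
intersections of nonempty subcollections of `𝒞`. -/
def IsSource {B : Type v} (𝒞 : Set (Set B)) (Y : Set B) : Prop :=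
  ∃ 𝒟 ⊆ deltaFamily 𝒞, Y = ⋃₀ 𝒟

/-- There is a countable open source for `X` in the given compactification `e : X → B`. -/
def IsSSpaceIn {X : Type u} {B : Type v} [TopologicalSpace B] (e : X → B) : Prop :=
  ∃ 𝒞 : Set (Set B), 𝒞.Countable ∧ (∀ U ∈ 𝒞, IsOpen U) ∧ IsSource 𝒞 (range e)

/-- `X` is an `s`-space: there is a countable open source for `X` in some compactification of `X`
(equivalently in any, see `IsSSpace.forall_compactification`). -/
def IsSSpace (X : Type u) [TopologicalSpace X] : Prop :=
  ∃ (B : Type u) (_ : TopologicalSpace B) (e : X → B), IsCompactification e ∧ IsSSpaceIn e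

/-! The two notions do not depend on the compactification. -/

theorem IsCompactification.t35Space {X : Type u} {B : Type v} [TopologicalSpace X]
    [TopologicalSpace B] {e : X → B} (he : IsCompactification e) : T35Space X := by
  have := he.compactSpace
  have := he.t2Space
  exact he.isDenseEmbedding.isEmbedding.t35Space

theorem isCompactification_stoneCechUnit (X : Type u) [TopologicalSpace X] [T35Space X] :
    IsCompactification (stoneCechUnit : X → StoneCech X) :=
  ⟨inferInstance, inferInstance, isDenseEmbedding_stoneCechUnit⟩

/-- A map of compactifications sends remainder to remainder. -/
theorem IsCompactification.eq_of_map_eq {X : Type u} {B : Type v} {B' : Type w}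
    [TopologicalSpace X] [TopologicalSpace B] [TopologicalSpace B'] {e : X → B} {e' : X → B'}
    (he : IsCompactification e) (he' : IsCompactification e') {f : B → B'} (hf : Continuous f)
    (hfe : ∀ x, f (e x) = e' x) {b : B} {x : X} (h : f b = e' x) : b = e x := by
  have := he.t2Space
  by_contra hne
  obtain ⟨U, V, hU, hV, hbU, hxV, hUV⟩ := t2_separation hne
  obtain ⟨W, hW, hWV⟩ := he'.isDenseEmbedding.isInducing.isOpen_iff.1
    (hV.preimage he.isDenseEmbedding.continuous)
  have hxW : e' x ∈ W := by
    have : x ∈ e' ⁻¹' W := by rw [hWV]; exact hxV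
    exact this
  obtain ⟨x', hx'⟩ := he.isDenseEmbedding.dense.exists_mem_open
    (hU.inter (hW.preimage hf)) ⟨b, hbU, by simpa [h] using hxW⟩
  have h1 : x' ∈ e' ⁻¹' W := by simpa [hfe] using hx'.2
  rw [hWV] at h1
  exact disjoint_left.1 hUV hx'.1 h1

/-- The open image `B' \ f (B \ U)` of an open set `U`. -/
theorem isOpen_smallImage {B : Type v} {B' : Type w} [TopologicalSpace B] [TopologicalSpace B']
    [CompactSpace B] [T2Space B'] {f : B → B'} (hf : Continuous f) {U : Set B} (hU : IsOpen U) :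
    IsOpen (f '' Uᶜ)ᶜ :=
  (hf.isClosedMap _ hU.isClosed_compl).isOpen_compl

theorem IsPSpaceIn.comap {X : Type u} {B : Type v} {B' : Type w}
    [TopologicalSpace X] [TopologicalSpace B] [TopologicalSpace B'] {e : X → B} {e' : X → B'}
    (he : IsCompactification e) (he' : IsCompactification e') {f : B → B'} (hf : Continuous f)
    (hfe : ∀ x, f (e x) = e' x) (h : IsPSpaceIn e') : IsPSpaceIn e := by
  obtain ⟨𝒰, ho, h⟩ := h
  refine ⟨fun n => (fun U => f ⁻¹' U) '' 𝒰 n, ?_, fun x => ⟨?_, ?_⟩⟩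
  · rintro n _ ⟨U, hU, rfl⟩
    exact (ho n U hU).preimage hf
  · refine mem_iInter.2 fun n => ?_
    obtain ⟨U, ⟨hU, hx⟩, -⟩ := mem_iInter.1 (h x).1 n
    have hx' : e x ∈ f ⁻¹' U := by simpa [hfe] using hx
    exact ⟨_, ⟨⟨U, hU, rfl⟩, hx'⟩, hx'⟩
  · intro b hb
    have : f b ∈ range e' := by
      refine (h x).2 (mem_iInter.2 fun n => ?_)
      obtain ⟨_, ⟨⟨U, hU, rfl⟩, hx⟩, hbU⟩ := mem_iInter.1 hb n
      exact ⟨U, ⟨hU, by simpa [hfe] using hx⟩, hbU⟩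
    obtain ⟨x', hx'⟩ := this
    exact ⟨x', (he.eq_of_map_eq he' hf hfe hx'.symm).symm⟩

theorem IsPSpaceIn.map {X : Type u} {B : Type v} {B' : Type w}
    [TopologicalSpace X] [TopologicalSpace B] [TopologicalSpace B'] {e : X → B} {e' : X → B'}
    (he : IsCompactification e) (he' : IsCompactification e') {f : B → B'} (hf : Continuous f)
    (hs : Function.Surjective f)
    (hfe : ∀ x, f (e x) = e' x) (h : IsPSpaceIn e) : IsPSpaceIn e' := by
  have := he.compactSpace
  have := he'.t2Space
  obtain ⟨𝒰, ho, h⟩ := h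
  refine ⟨fun n => (fun U => (f '' Uᶜ)ᶜ) '' 𝒰 n, ?_, fun x => ⟨?_, ?_⟩⟩
  · rintro n _ ⟨U, hU, rfl⟩
    exact isOpen_smallImage hf (ho n U hU)
  · refine mem_iInter.2 fun n => ?_
    obtain ⟨U, ⟨hU, hx⟩, -⟩ := mem_iInter.1 (h x).1 n
    have hx' : e' x ∈ (f '' Uᶜ)ᶜ := by
      rintro ⟨b, hb, hbx⟩
      exact hb (he.eq_of_map_eq he' hf hfe hbx ▸ hx)
    exact ⟨_, ⟨⟨U, hU, rfl⟩, hx'⟩, hx'⟩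
  · intro b' hb'
    obtain ⟨b, rfl⟩ := hs b'
    have : b ∈ range e := by
      refine (h x).2 (mem_iInter.2 fun n => ?_)
      obtain ⟨_, ⟨⟨U, hU, rfl⟩, hx⟩, hbU⟩ := mem_iInter.1 hb' n
      refine ⟨U, ⟨hU, ?_⟩, ?_⟩
      · by_contra hc
        exact hx ⟨e x, hc, hfe x⟩
      · by_contra hc
        exact hbU ⟨b, hc, rfl⟩
    obtain ⟨x', rfl⟩ := this
    exact ⟨x', (hfe x').symm⟩

/-- `𝒞` is a source for `Y` iff each point of `Y` lies in an intersection, contained in `Y`,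
of a nonempty subcollection. -/
theorem isSource_iff {B : Type v} {𝒞 : Set (Set B)} {Y : Set B} :
    IsSource 𝒞 Y ↔ ∀ y ∈ Y, ∃ 𝒮 ⊆ 𝒞, 𝒮.Nonempty ∧ y ∈ ⋂₀ 𝒮 ∧ ⋂₀ 𝒮 ⊆ Y := by
  constructor
  · rintro ⟨𝒟, h𝒟, rfl⟩ y ⟨A, hA, hy⟩
    obtain ⟨𝒮, h1, h2, rfl⟩ := h𝒟 hA
    exact ⟨𝒮, h1, h2, hy, subset_sUnion_of_mem hA⟩
  · intro h
    refine ⟨{A | A ∈ deltaFamily 𝒞 ∧ A ⊆ Y}, fun A hA => hA.1, ?_⟩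
    refine Subset.antisymm (fun y hy => ?_) (sUnion_subset fun A hA => hA.2)
    obtain ⟨𝒮, h1, h2, h3, h4⟩ := h y hy
    exact ⟨_, ⟨⟨𝒮, h1, h2, rfl⟩, h4⟩, h3⟩

theorem IsSSpaceIn.comap {X : Type u} {B : Type v} {B' : Type w}
    [TopologicalSpace X] [TopologicalSpace B] [TopologicalSpace B'] {e : X → B} {e' : X → B'}
    (he : IsCompactification e) (he' : IsCompactification e') {f : B → B'} (hf : Continuous f)
    (hfe : ∀ x, f (e x) = e' x) (h : IsSSpaceIn e') : IsSSpaceIn e := by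
  obtain ⟨𝒞, hc, ho, h⟩ := h
  rw [isSource_iff] at h
  refine ⟨(fun U => f ⁻¹' U) '' 𝒞, hc.image _, ?_, isSource_iff.2 ?_⟩
  · rintro _ ⟨U, hU, rfl⟩
    exact (ho U hU).preimage hf
  · rintro _ ⟨x, rfl⟩
    obtain ⟨𝒮, h1, h2, h3, h4⟩ := h (e' x) ⟨x, rfl⟩
    refine ⟨_, image_mono h1, h2.image _, ?_, fun b hb => ?_⟩
    · rintro _ ⟨U, hU, rfl⟩
      simpa [hfe] using h3 U hU
    · obtain ⟨x', hx'⟩ := h4 (show f b ∈ ⋂₀ 𝒮 from fun U hU => hb _ ⟨U, hU, rfl⟩)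
      exact ⟨x', (he.eq_of_map_eq he' hf hfe hx'.symm).symm⟩

theorem IsSSpaceIn.map {X : Type u} {B : Type v} {B' : Type w}
    [TopologicalSpace X] [TopologicalSpace B] [TopologicalSpace B'] {e : X → B} {e' : X → B'}
    (he : IsCompactification e) (he' : IsCompactification e') {f : B → B'} (hf : Continuous f)
    (hs : Function.Surjective f)
    (hfe : ∀ x, f (e x) = e' x) (h : IsSSpaceIn e) : IsSSpaceIn e' := by
  have := he.compactSpace
  have := he'.t2Space
  obtain ⟨𝒞, hc, ho, h⟩ := h
  rw [isSource_iff] at h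
  refine ⟨(fun U => (f '' Uᶜ)ᶜ) '' 𝒞, hc.image _, ?_, isSource_iff.2 ?_⟩
  · rintro _ ⟨U, hU, rfl⟩
    exact isOpen_smallImage hf (ho U hU)
  · rintro _ ⟨x, rfl⟩
    obtain ⟨𝒮, h1, h2, h3, h4⟩ := h (e x) ⟨x, rfl⟩
    refine ⟨_, image_mono h1, h2.image _, ?_, fun b' hb' => ?_⟩
    · rintro _ ⟨U, hU, rfl⟩
      rintro ⟨b, hb, hbx⟩
      exact hb (he.eq_of_map_eq he' hf hfe hbx ▸ h3 U hU)
    · obtain ⟨b, rfl⟩ := hs b'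
      obtain ⟨x', rfl⟩ := h4 (show b ∈ ⋂₀ 𝒮 from fun U hU => by
        by_contra hc
        exact hb' _ ⟨U, hU, rfl⟩ ⟨b, hc, rfl⟩)
      exact ⟨x', (hfe x').symm⟩

/-- Every compactification is a quotient of the Stone-Čech compactification. -/
theorem IsCompactification.exists_stoneCech_map {X : Type u} {B : Type v} [TopologicalSpace X]
    [TopologicalSpace B] {e : X → B} (he : IsCompactification e) :
    ∃ f : StoneCech X → B, Continuous f ∧ Function.Surjective f ∧
      ∀ x, f (stoneCechUnit x) = e x := by
  have := he.compactSpace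
  have := he.t2Space
  have hc := he.isDenseEmbedding.continuous
  have hx : ∀ x, stoneCechExtend hc (stoneCechUnit x) = e x := stoneCechExtend_stoneCechUnit hc
  refine ⟨stoneCechExtend hc, continuous_stoneCechExtend hc, ?_, hx⟩
  have hcl : IsClosed (range (stoneCechExtend hc)) :=
    (isCompact_range (continuous_stoneCechExtend hc)).isClosed
  have hd : Dense (range (stoneCechExtend hc)) :=
    he.isDenseEmbedding.dense.mono (by rintro _ ⟨x, rfl⟩; exact ⟨_, hx x⟩)
  exact range_eq_univ.1 (hcl.closure_eq ▸ hd.closure_eq)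

theorem IsPSpace.forall_compactification {X : Type u} [TopologicalSpace X] (h : IsPSpace X)
    {B : Type v} [TopologicalSpace B] {e : X → B} (he : IsCompactification e) :
    IsPSpaceIn e := by
  obtain ⟨B', _, e', he', h⟩ := h
  have := he.t35Space
  have hS := isCompactification_stoneCechUnit X
  obtain ⟨f, hf, -, hfe⟩ := he'.exists_stoneCech_map
  obtain ⟨g, hg, hgs, hge⟩ := he.exists_stoneCech_map
  exact (h.comap hS he' hf hfe).map hS he hg hgs hge

theorem IsSSpace.forall_compactification {X : Type u} [TopologicalSpace X] (h : IsSSpace X)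
    {B : Type v} [TopologicalSpace B] {e : X → B} (he : IsCompactification e) :
    IsSSpaceIn e := by
  obtain ⟨B', _, e', he', h⟩ := h
  have := he.t35Space
  have hS := isCompactification_stoneCechUnit X
  obtain ⟨f, hf, -, hfe⟩ := he'.exists_stoneCech_map
  obtain ⟨g, hg, hgs, hge⟩ := he.exists_stoneCech_map
  exact (h.comap hS he' hf hfe).map hS he hg hgs hge

open Topology

/-! The Menger property enters only through Lindelöfness. Take `K` to be the part of `B` outside an
open set, containing `X`, whose trace on `X` is covered by the given Menger subspaces. If `F` misses
`K`, compactness puts the closure `C` of `F` in finitely many of the chosen open sets, so `C ∩ X` is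
Lindelöf. The `p`-structure of `X` then yields countably many real functions on `B` separating `C ∩
X` from the remainder (`IsPSpaceIn.exists_separating_map`). As `C \ F ⊆ X`, the resulting map `G`
makes `F` a full preimage, under a map from the compact space `C`, of a separable metrizable space.
The three `of_separating_map` lemmas read off the conclusions. -/

/-- The preimage of a Lindelöf set under a proper map is Lindelöf. -/
theorem IsProperMap.isLindelof_preimage {X : Type u} {Y : Type v} [TopologicalSpace X]
    [TopologicalSpace Y] {f : X → Y} (hf : IsProperMap f) {s : Set Y} (hs : IsLindelof s) :
    IsLindelof (f ⁻¹' s) := by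
  intro l _ _ hl
  obtain ⟨y, hy, hyl⟩ := @hs (l.map f) _ _ (by simpa [Filter.map_le_iff_le_comap] using hl)
  obtain ⟨x, rfl, hx⟩ := ((isProperMap_iff_clusterPt f).1 hf).2 hyl
  exact ⟨x, hy, hx⟩

/-- Apply the selection principle to a constant sequence of covers: countably many finite
subfamilies form a countable subcover. -/
theorem IsMenger.lindelofSpace {X : Type u} [TopologicalSpace X] (h : IsMenger X) :
    LindelofSpace X := by
  refine ⟨isLindelof_of_countable_subcover fun {ι} U hU hc => ?_⟩
  obtain ⟨𝒱, h𝒱, hcov⟩ := h (fun _ => range U) fun _ =>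
    ⟨by rintro _ ⟨i, rfl⟩; exact hU i, by simpa [univ_subset_iff] using hc⟩
  have hι : ∀ W : ⋃ n, 𝒱 n, ∃ i, U i = W := fun W =>
    let ⟨n, hn⟩ := mem_iUnion.1 W.2
    (h𝒱 n).1 hn
  choose i hi using hι
  have := (countable_iUnion fun n => (h𝒱 n).2.countable).to_subtype
  refine ⟨range i, countable_range i, fun x _ => ?_⟩
  obtain ⟨n, W, hW, hxW⟩ := mem_iUnion.1 (hcov.symm ▸ mem_univ x)
  let W' : ⋃ n, 𝒱 n := ⟨W, mem_iUnion.2 ⟨n, hW⟩⟩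
  exact mem_iUnion₂.2 ⟨i W', mem_range_self W', (hi W').symm ▸ hxW⟩

/-- A Lindelöf subspace of a `p`-space is separated from the remainder by a continuous map to a
separable metrizable space. -/
theorem IsPSpaceIn.exists_separating_map {X : Type u} {B : Type v} [TopologicalSpace X]
    [TopologicalSpace B] [CompactSpace B] [T2Space B] {e : X → B} (he : Continuous e)
    (hp : IsPSpaceIn e) {P : Set X} (hP : IsLindelof P) :
    ∃ (ι : Type u) (_ : Countable ι) (G : B → ι → ℝ), Continuous G ∧
      ∀ x ∈ P, ∀ y ∉ range e, G (e x) ≠ G y := by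
  obtain ⟨𝒰, ho, h⟩ := hp
  have hg : ∀ n x, ∃ g : C(B, ℝ), g (e x) = 1 ∧ ∃ U ∈ 𝒰 n, ∀ b, g b ≠ 0 → b ∈ U := by
    intro n x
    obtain ⟨U, ⟨hU, hx⟩, -⟩ := mem_iInter.1 (h x).1 n
    obtain ⟨g, hg0, hg1, -⟩ := exists_continuous_zero_one_of_isClosed
      (ho n U hU).isClosed_compl (isClosed_singleton (x := e x)) (by simpa using hx)
    exact ⟨g, hg1 rfl, U, hU, fun b hb => by_contra fun hbU => hb (hg0 hbU)⟩
  choose g hg1 U hU hgU using hg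
  have ht : ∀ n, ∃ t : Set X, t.Countable ∧ P ⊆ ⋃ x ∈ t, {z | g n x (e z) ≠ 0} := by
    intro n
    obtain ⟨t, ht, -, hcov⟩ := hP.elim_nhds_subcover (fun x => {z | g n x (e z) ≠ 0}) fun x _ =>
      (isOpen_ne.preimage ((g n x).continuous.comp he)).mem_nhds (by simp [hg1])
    exact ⟨t, ht, hcov⟩
  choose t htc ht using ht
  have := fun n => (htc n).to_subtype
  -- If `G (e x) = G y`, then at each level `n` some chosen function is nonzero at both points, so
  -- one member of `𝒰 n` contains both and `y` lies in every star of `e x`.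
  refine ⟨Σ n, t n, inferInstance, fun b i => g i.1 i.2 b, by fun_prop, fun x hx y hy hxy => hy ?_⟩
  refine (h x).2 (mem_iInter.2 fun n => ?_)
  obtain ⟨z, hz, hxz⟩ := mem_iUnion₂.1 (ht n hx)
  have hyz : g n z (e x) = g n z y := congrFun hxy ⟨n, z, hz⟩
  exact ⟨U n z, ⟨hU n z, hgU n z _ hxz⟩, hgU n z _ (hyz ▸ hxz)⟩

section Separating

variable {X : Type u} {B : Type v} {M : Type w} [TopologicalSpace B]
  [TopologicalSpace M] {e : X → B} {G : B → M}

/-- Preimages of balls with radii tending to zero: the stars of `e x` shrink to the fibre of `G`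
through `e x`, which misses the remainder. -/
theorem IsPSpaceIn.of_separating_map [TopologicalSpace.MetrizableSpace M] (hG : Continuous G)
    (hs : ∀ x, ∀ y ∉ range e, G (e x) ≠ G y) : IsPSpaceIn e := by
  let _ := TopologicalSpace.metrizableSpaceMetric M
  refine ⟨fun n => range fun q => G ⁻¹' Metric.ball q (1 / (n + 1)), ?_, fun x => ⟨?_, ?_⟩⟩
  · rintro n _ ⟨q, rfl⟩
    exact Metric.isOpen_ball.preimage hG
  · refine mem_iInter.2 fun n => ?_
    have hx : e x ∈ G ⁻¹' Metric.ball (G (e x)) (1 / (n + 1)) :=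
      Metric.mem_ball_self Nat.one_div_pos_of_nat
    exact ⟨_, ⟨⟨_, rfl⟩, hx⟩, hx⟩
  · intro b hb
    by_contra hbe
    obtain ⟨n, hn⟩ := exists_nat_one_div_lt (half_pos (dist_pos.2 (hs x b hbe)))
    obtain ⟨_, ⟨⟨q, rfl⟩, hx⟩, hbq⟩ := mem_iInter.1 hb n
    have h1 : dist (G (e x)) q < 1 / (n + 1) := hx
    have h2 : dist (G b) q < 1 / (n + 1) := hbq
    linarith [dist_triangle_right (G (e x)) (G b) q]

/-- The source is the preimage of a countable base: the base members around `G (e x)` intersect in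
that point alone. -/
theorem IsSSpaceIn.of_separating_map [T1Space M] [SecondCountableTopology M]
    (hG : Continuous G) (hs : ∀ x, ∀ y ∉ range e, G (e x) ≠ G y) : IsSSpaceIn e := by
  have hb := TopologicalSpace.isBasis_countableBasis M
  refine ⟨(fun U => G ⁻¹' U) '' TopologicalSpace.countableBasis M,
    (TopologicalSpace.countable_countableBasis M).image _, ?_, isSource_iff.2 ?_⟩
  · rintro _ ⟨U, hU, rfl⟩
    exact (hb.isOpen hU).preimage hG
  · rintro _ ⟨x, rfl⟩
    refine ⟨(fun U => G ⁻¹' U) '' {U ∈ TopologicalSpace.countableBasis M | G (e x) ∈ U},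
      image_mono fun U hU => hU.1, ?_, ?_, fun y hy => ?_⟩
    · obtain ⟨U, hU, hx, -⟩ := hb.exists_subset_of_mem_open (mem_univ (G (e x))) isOpen_univ
      exact ⟨_, U, ⟨hU, hx⟩, rfl⟩
    · rintro _ ⟨U, hU, rfl⟩
      exact hU.2
    · by_contra hye
      obtain ⟨U, hU, hx, hUy⟩ := hb.exists_subset_of_mem_open
        (show G (e x) ∈ {G y}ᶜ from hs x y hye) isOpen_compl_singleton
      exact hUy (hy _ ⟨U, ⟨hU, hx⟩, rfl⟩) rfl

/-- Separation makes `range e` a union of fibres of the proper map `G`, and every subset of `M` is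
Lindelöf. -/
theorem lindelofSpace_of_separating_map [TopologicalSpace X] [CompactSpace B] [T2Space M] [SecondCountableTopology M]
    (he : IsInducing e) (hG : Continuous G) (hs : ∀ x, ∀ y ∉ range e, G (e x) ≠ G y) :
    LindelofSpace X := by
  have hpre : G ⁻¹' (G '' range e) = range e := by
    refine Subset.antisymm ?_ (subset_preimage_image _ _)
    rintro y ⟨_, ⟨x, rfl⟩, hxy⟩
    by_contra hy
    exact hs x y hy hxy
  have hL : IsLindelof (range e) :=
    hpre ▸ hG.isProperMap.isLindelof_preimage (HereditarilyLindelofSpace.isLindelof _)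
  rwa [← image_univ, ← he.isLindelof_iff, isLindelof_univ_iff] at hL

end Separating

/-- A subset embeds as a dense subspace of its closure in a compact Hausdorff space. -/
theorem IsCompactification.codRestrict_closure {Y : Type u} {B : Type v} [TopologicalSpace Y]
    [TopologicalSpace B] [CompactSpace B] [T2Space B] {j : Y → B} (hj : IsEmbedding j) :
    IsCompactification (codRestrict j (closure (range j)) fun y => subset_closure ⟨y, rfl⟩) where
  compactSpace := isCompact_iff_compactSpace.1 isClosed_closure.isCompact
  t2Space := inferInstance
  isDenseEmbedding :=
    { toIsInducing := (hj.codRestrict _ _).isInducing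
      injective := (hj.codRestrict _ _).injective
      dense := by
        intro b
        rw [IsInducing.subtypeVal.closure_eq_preimage_closure_image, mem_preimage, ← range_comp]
        exact b.2 }

theorem mainTheorem9 {X : Type u} [TopologicalSpace X] [T3Space X]
    (hM : IsLocallyMenger X) (hp : IsPSpace X)
    {B : Type v} [TopologicalSpace B] (e : X → B) (he : IsCompactification e) :
    ∃ K : Set ↥(remainder e), IsCompact K ∧
      ∀ F : Set ↥(remainder e), IsClosed F → Disjoint K F →
        LindelofSpace ↥F ∧ IsPSpace ↥F ∧ IsSSpace ↥F := by
  have := he.compactSpace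
  have := he.t2Space
  have hec := he.isDenseEmbedding.continuous
  choose U M hU hMM hxU hUM using hM
  choose V hV hVU using fun x => he.isDenseEmbedding.isInducing.isOpen_iff.1 (hU x)
  have hxV : ∀ x, e x ∈ V x := fun x => (hVU x).symm.subset (hxU x)
  -- The complement of `⋃ x, V x` is closed in `B` and misses `X`, so it is a compact part of the
  -- remainder.
  refine ⟨Subtype.val ⁻¹' (⋃ x, V x)ᶜ, ?_, fun F hF hKF => ?_⟩
  · refine IsInducing.subtypeVal.isCompact_preimage' (isOpen_iUnion hV).isClosed_compl.isCompact ?_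
    rw [Subtype.range_coe]
    rintro b hb ⟨x, rfl⟩
    exact hb (mem_iUnion.2 ⟨x, hxV x⟩)
  let j : F → B := fun y => y.1.1
  have hj : IsEmbedding j := IsEmbedding.subtypeVal.comp IsEmbedding.subtypeVal
  have hcl : ∀ b (hb : b ∈ remainder e), b ∈ closure (range j) → (⟨b, hb⟩ : remainder e) ∈ F := by
    intro b hb hbc
    rw [← hF.closure_eq, IsInducing.subtypeVal.closure_eq_preimage_closure_image, mem_preimage]
    rwa [show range j = Subtype.val '' F by ext; simp [j]] at hbc
  have hCV : closure (range j) ⊆ ⋃ x, V x := by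
    intro b hb
    by_contra hbV
    have hbr : b ∈ remainder e := by
      rintro ⟨x, rfl⟩
      exact hbV (mem_iUnion.2 ⟨x, hxV x⟩)
    exact disjoint_left.1 hKF hbV (hcl b hbr hb)
  obtain ⟨t, ht⟩ := isClosed_closure.isCompact.elim_finite_subcover V hV hCV
  have hP : IsLindelof (e ⁻¹' closure (range j)) := by
    refine (t.isLindelof_biUnion (f := M) fun x _ =>
      isLindelof_iff_lindelofSpace.2 (hMM x).lindelofSpace).of_isClosed_subset
      (isClosed_closure.preimage hec) fun z hz => ?_
    obtain ⟨x, hxt, hzx⟩ := mem_iUnion₂.1 (ht hz)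
    exact mem_iUnion₂.2 ⟨x, hxt, hUM x (hVU x ▸ hzx)⟩
  obtain ⟨ι, _, G, hG, hsep⟩ := (hp.forall_compactification he).exists_separating_map hec hP
  have hk := IsCompactification.codRestrict_closure hj
  have := hk.compactSpace
  have hGk : Continuous fun b : closure (range j) => G b := hG.comp continuous_subtype_val
  -- A point of the closure outside `F` must come from `X`, because `F` is closed in the remainder.
  have hs : ∀ y, ∀ b ∉ range (codRestrict j (closure (range j)) fun y => subset_closure ⟨y, rfl⟩),
      G (j y) ≠ G b := by
    rintro y ⟨b, hb⟩ hbF hyb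
    have hbX : b ∈ range e := by
      by_contra hbr
      exact hbF ⟨⟨⟨b, hbr⟩, hcl b hbr hb⟩, rfl⟩
    obtain ⟨x, rfl⟩ := hbX
    exact hsep x hb (j y) y.1.2 hyb.symm
  exact ⟨lindelofSpace_of_separating_map hk.isDenseEmbedding.isInducing hGk hs,
    ⟨_, _, _, hk, IsPSpaceIn.of_separating_map hGk hs⟩,
    ⟨_, _, _, hk, IsSSpaceIn.of_separating_map hGk hs⟩⟩
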